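/- For nonzero polynomials $A,B\in\mathbb{R}[t]$ let $\langle A,B\rangle$ denote the quadratic form $Ax^2+By^2$ on $\mathbb{R}(t)^2$; two forms $q_1,q_2$ are equivalent over $\mathbb{R}(t)$ if $q_1(v)=q_2(Mv)$ for all $v$, for some $M\in\mathrm{GL}_2(\mathbb{R}(t))$. If $\varepsilon\in\mathbb{R}$ is a root of $Q\in\mathbb{R}[t]$, put $Q_\varepsilon=Q/(t-\varepsilon)$. For a nonzero polynomial $Q$ let $\lambda_Q$ be its leading coefficient. Real numbers are said to have the same sign if they are all positive or all negative. Let $A,B,C,D\in\mathbb{R}[t]$ be squarefree (in particular nonzero) polynomials. Then $\langle A,B\rangle$ and $\langle C,D\rangle$ are equivalent over $\mathbb{R}(t)$ if and only if the following three conditions hold. (1) $ABCD$ is a square in $\mathbb{R}(t)$ (equivalently, $AB=g^2\,CD$ for some $g\in\mathbb{R}(t)^*$). (2) For every real root $\varepsilon$ of $A$: (2.a) if $B(\varepsilon)\neq 0$, then $A_\varepsilon(\varepsilon)C_\varepsilon(\varepsilon)>0$ when $C(\varepsilon)=0$, and $A_\varepsilon(\varepsilon)D_\varepsilon(\varepsilon)>0$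 when $D(\varepsilon)=0$; (2.b) if $B(\varepsilon)=0$ and $C(\varepsilon),D(\varepsilon)\neq 0$, then $A_\varepsilon(\varepsilon)B_\varepsilon(\varepsilon)<0$; (2.c) if $B(\varepsilon)=C(\varepsilon)=D(\varepsilon)=0$, then either $A_\varepsilon(\varepsilon)B_\varepsilon(\varepsilon)<0$ and $C_\varepsilon(\varepsilon)D_\varepsilon(\varepsilon)<0$, or $A_\varepsilon(\varepsilon),B_\varepsilon(\varepsilon),C_\varepsilon(\varepsilon),D_\varepsilon(\varepsilon)$ all have the same sign; and the same conditions hold at the real roots of $B$, of $C$ and of $D$, that is, with $(A,B,C,D)$ replaced by $(B,A,C,D)$, by $(C,D,A,B)$ and by $(D,C,A,B)$. (3) One of the following holds: - exactly one of $A,B$ and exactly one of $C,D$ has odd degree, and the leading coefficients of the two even-degree polynomials have the same sign; - $\deg A,\deg B,\deg C,\deg D$ are all odd; - $\deg A,\deg B$ are odd, $\deg C,\deg D$ are even, and $\lambda_C\lambda_D<0$; - $\deg A,\deg B$ are even, $\deg C,\deg D$ are odd, and $\lambda_A\lambda_B<0$; - $\deg A,\deg B,\deg C,\deg D$ are all even,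 and either $\lambda_A\lambda_B<0$ and $\lambda_C\lambda_D<0$, or $\lambda_A,\lambda_B,\lambda_C,\lambda_D$ all have the same sign. -/

import Mathlib

/-- The binary diagonal quadratic form `⟨A, B⟩ : (x, y) ↦ A x² + B y²` over `ℝ(t)`
attached to two real polynomials. -/
noncomputable def diagForm (A B : Polynomial ℝ) : QuadraticForm (RatFunc ℝ) (Fin 2 → RatFunc ℝ) :=
  QuadraticMap.weightedSumSquares (RatFunc ℝ)
    ![algebraMap (Polynomial ℝ) (RatFunc ℝ) A, algebraMap (Polynomial ℝ) (RatFunc ℝ) B]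

/-- For a real root `ε` of `Q`, the value `Q_ε(ε)` at `ε` of the quotient
`Q_ε = Q / (t - ε)`. It is only used when `Q(ε) = 0`, so that the division is exact. -/
noncomputable def quotEval (Q : Polynomial ℝ) (ε : ℝ) : ℝ :=
  (Q /ₘ (Polynomial.X - Polynomial.C ε)).eval ε

/-- Four real numbers have the same (nonzero) sign. -/
def AllSameSign (a b c d : ℝ) : Prop :=
  (0 < a ∧ 0 < b ∧ 0 < c ∧ 0 < d) ∨ (a < 0 ∧ b < 0 ∧ c < 0 ∧ d < 0)

/-- The sign conditions at the real roots `ε` of the first polynomial `A`. -/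
def SignCondAtRootsOfFirst (A B C D : Polynomial ℝ) : Prop :=
  ∀ ε : ℝ, A.eval ε = 0 →
    (B.eval ε ≠ 0 →
      (C.eval ε = 0 → 0 < quotEval A ε * quotEval C ε) ∧
      (D.eval ε = 0 → 0 < quotEval A ε * quotEval D ε)) ∧
    (B.eval ε = 0 → C.eval ε ≠ 0 → D.eval ε ≠ 0 →
      quotEval A ε * quotEval B ε < 0) ∧
    (B.eval ε = 0 → C.eval ε = 0 → D.eval ε = 0 →
      (quotEval A ε * quotEval B ε < 0 ∧ quotEval C ε * quotEval D ε < 0) ∨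
      AllSameSign (quotEval A ε) (quotEval B ε) (quotEval C ε) (quotEval D ε))

/-- The sign conditions at the real roots of all four polynomials: each of `A, B, C, D` in turn
plays the role of the first polynomial, the other member of its pair that of the second one. -/
def SignCondAtRoots (A B C D : Polynomial ℝ) : Prop :=
  SignCondAtRootsOfFirst A B C D ∧ SignCondAtRootsOfFirst B A C D ∧
  SignCondAtRootsOfFirst C D A B ∧ SignCondAtRootsOfFirst D C A B

/-- The conditions on the parities of the degrees and on the signs of the leading coefficients. -/
def DegreeCond (A B C D : Polynomial ℝ) : Prop :=
  (Xor (Odd A.natDegree) (Odd B.natDegree) ∧ Xor (Odd C.natDegree) (Odd D.natDegree) ∧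
    ∀ P ∈ ({A, B} : Set (Polynomial ℝ)), ∀ Q ∈ ({C, D} : Set (Polynomial ℝ)),
      Even P.natDegree → Even Q.natDegree → 0 < P.leadingCoeff * Q.leadingCoeff) ∨
  (Odd A.natDegree ∧ Odd B.natDegree ∧ Odd C.natDegree ∧ Odd D.natDegree) ∨
  (Odd A.natDegree ∧ Odd B.natDegree ∧ Even C.natDegree ∧ Even D.natDegree ∧
    C.leadingCoeff * D.leadingCoeff < 0) ∨
  (Even A.natDegree ∧ Even B.natDegree ∧ Odd C.natDegree ∧ Odd D.natDegree ∧
    A.leadingCoeff * B.leadingCoeff < 0) ∨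
  (Even A.natDegree ∧ Even B.natDegree ∧ Even C.natDegree ∧ Even D.natDegree ∧
    ((A.leadingCoeff * B.leadingCoeff < 0 ∧ C.leadingCoeff * D.leadingCoeff < 0) ∨
      AllSameSign A.leadingCoeff B.leadingCoeff C.leadingCoeff D.leadingCoeff))

/-! A binary form over a field is determined by its discriminant up to squares and one nonzero value
it represents. Given (1), equivalence thus means that `⟨A, B⟩` represents `C`, i.e. that `A C x² - A
B y² = z²` has a nontrivial zero. Over `ℝ(t)`, `a x² + b y² = z²` is solvable as soon as `a` and `b`
are never both negative at a real point (`splitPair_of_nonneg`, by Legendre descent). Hence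
equivalence means equal discriminants and equal signatures at almost all real `t`
(`diagForm_equivalent_iff_eventually`).

The signature is constant between consecutive roots of `A B C D`, so it is enough to test it on both
sides of each root, or at infinity if there are no roots. Roots are simple, so the one-sided signs
there are those of `±Q_ε(ε)`, and (2) and (3) spell out the resulting sign conditions
(`signCond_and_degreeCond_iff`). -/

section

open Polynomial

/-! ### Solvability of conics over `ℝ[t]`. -/

/-- A real polynomial is a square modulo an irreducible one at whose real roots it is
nonnegative. -/
theorem exists_dvd_sq_sub_of_irreducible {b : ℝ[X]} (hb : Irreducible b) (a : ℝ[X])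
    (h : ∀ t, b.eval t = 0 → 0 ≤ a.eval t) : ∃ z : ℝ[X], b ∣ z ^ 2 - a := by
  obtain ⟨w, hw⟩ : ∃ w : ℂ, aeval w b = 0 :=
    IsAlgClosed.exists_aeval_eq_zero ℂ b (degree_pos_of_irreducible hb).ne'
  have key : ∀ p : ℝ[X], aeval w p = 0 → b ∣ p := fun p hp => by
    have h1 := minpoly.dvd ℝ w hp
    rw [← minpoly.eq_of_irreducible hb hw] at h1
    exact (dvd_mul_right _ _).trans h1
  by_cases him : w.im = 0
  · obtain ⟨r, rfl⟩ : ∃ r : ℝ, w = algebraMap ℝ ℂ r := ⟨w.re, by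
      apply Complex.ext <;> simp [him]⟩
    rw [aeval_algebraMap_apply] at hw
    have hr : b.eval r = 0 := by simpa using hw
    refine ⟨C (√(a.eval r)), key _ ?_⟩
    rw [aeval_algebraMap_apply]
    simp [Real.sq_sqrt (h r hr)]
  · obtain ⟨s, hs⟩ := IsAlgClosed.exists_pow_nat_eq (aeval w a) two_pos
    -- As `w` is not real, `1, w` is a real basis of `ℂ`; this linear polynomial takes the value `s
    -- = √(a(w))` at `w`.
    refine ⟨C (s.re - w.re * (s.im / w.im)) + C (s.im / w.im) * X, key _ ?_⟩
    have hz : aeval w (C (s.re - w.re * (s.im / w.im)) + C (s.im / w.im) * X) = s := by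
      apply Complex.ext
      · simp; ring
      · simp [field]
    rw [map_sub, map_pow, hz, hs, sub_self]

/-- Chinese remainder theorem: square roots modulo the distinct irreducible factors are glued
together. -/
theorem exists_dvd_sq_sub_of_squarefree {b : ℝ[X]} (hb : Squarefree b) (a : ℝ[X])
    (h : ∀ t, b.eval t = 0 → 0 ≤ a.eval t) : ∃ z : ℝ[X], b ∣ z ^ 2 - a := by
  induction b using WfDvdMonoid.induction_on_irreducible with
  | zero => exact absurd hb not_squarefree_zero
  | unit u hu => exact ⟨0, hu.dvd⟩
  | mul c p hc hp ih =>
    have hcop : IsCoprime p c := by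
      rw [hp.coprime_iff_not_dvd]
      intro hd
      exact hp.not_isUnit (hb p (mul_dvd_mul_left p hd))
    obtain ⟨z₁, h₁⟩ := exists_dvd_sq_sub_of_irreducible hp a fun t ht => h t (by simp [ht])
    obtain ⟨z₂, h₂⟩ := ih (hb.squarefree_of_dvd (dvd_mul_left c p))
      fun t ht => h t (by simp [ht])
    have ⟨u, v, huv⟩ := hcop
    refine ⟨z₁ * (v * c) + z₂ * (u * p), hcop.mul_dvd ?_ ?_⟩
    · obtain ⟨k, hk⟩ := h₁
      obtain rfl : a = z₁ ^ 2 - p * k := by rw [← hk]; ring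
      have : z₁ * (v * c) + z₂ * (u * p) = z₁ + p * (u * (z₂ - z₁)) := by
        linear_combination z₁ * huv
      exact ⟨2 * z₁ * (u * (z₂ - z₁)) + p * (u * (z₂ - z₁)) ^ 2 + k, by rw [this]; ring⟩
    · obtain ⟨k, hk⟩ := h₂
      obtain rfl : a = z₂ ^ 2 - c * k := by rw [← hk]; ring
      have : z₁ * (v * c) + z₂ * (u * p) = z₂ + c * (v * (z₁ - z₂)) := by
        linear_combination z₂ * huv
      exact ⟨2 * z₂ * (v * (z₁ - z₂)) + c * (v * (z₁ - z₂)) ^ 2 + k, by rw [this]; ring⟩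

/-- A squarefree polynomial changes sign at each of its real roots: if `b` is squarefree and
`a` is nonnegative wherever `b` is negative, then `a` is nonnegative at the roots of `b`. -/
theorem eval_nonneg_of_squarefree_root {a b : ℝ[X]} (hb : Squarefree b)
    (h : ∀ t, b.eval t < 0 → 0 ≤ a.eval t) {ε : ℝ} (hε : b.eval ε = 0) : 0 ≤ a.eval ε := by
  by_contra! hneg
  obtain ⟨q, rfl⟩ := dvd_iff_isRoot.mpr hε
  have hq : q.eval ε ≠ 0 := fun h0 => by
    obtain ⟨r, rfl⟩ := dvd_iff_isRoot.mpr h0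
    exact not_isUnit_X_sub_C ε (hb _ ⟨r, by ring⟩)
  have hopen : ∀ᶠ t in nhds ε, a.eval t < 0 ∧ 0 < q.eval t * q.eval ε :=
    (a.continuous.continuousAt.eventually_lt_const hneg).and
      ((q.continuous.mul continuous_const).continuousAt.eventually_const_lt
        (mul_self_pos.mpr hq))
  have hsub : ∀ t, a.eval t < 0 → 0 ≤ (t - ε) * q.eval t := fun t ht => by
    by_contra! hlt
    exact absurd (h t (by simpa using hlt)) (not_le.mpr ht)
  -- Move to the side of `ε` where `t - ε` and `q(ε)` have opposite signs: there `b < 0`, and `a <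
  -- 0` by continuity.
  rcases hq.lt_or_gt with hq | hq
  · obtain ⟨t, ⟨hta, htq⟩, ht⟩ := ((hopen.filter_mono nhdsWithin_le_nhds).and
      (eventually_mem_nhdsWithin (s := Set.Ioi ε))).exists
    have := hsub t hta
    have ht : ε < t := ht
    nlinarith [neg_of_mul_pos_left htq hq.le]
  · obtain ⟨t, ⟨hta, htq⟩, ht⟩ := ((hopen.filter_mono nhdsWithin_le_nhds).and
      (eventually_mem_nhdsWithin (s := Set.Iio ε))).exists
    have := hsub t hta
    have ht : t < ε := ht
    nlinarith [pos_of_mul_pos_left htq hq.le]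

/-- The polynomial `a x² + b y² - z²` has a nontrivial zero over `ℝ[t]`. -/
def SplitPair (a b : ℝ[X]) : Prop :=
  ∃ x y z : ℝ[X], (x ≠ 0 ∨ y ≠ 0) ∧ z ^ 2 = a * x ^ 2 + b * y ^ 2

theorem SplitPair.symm {a b : ℝ[X]} (h : SplitPair a b) : SplitPair b a := by
  obtain ⟨x, y, z, hxy, h⟩ := h
  exact ⟨y, x, z, hxy.symm, by rw [h, add_comm]⟩

theorem SplitPair.mul_sq {a b : ℝ[X]} (h : SplitPair a b) {s : ℝ[X]} (hs : s ≠ 0) :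
    SplitPair a (s ^ 2 * b) := by
  obtain ⟨x, y, z, hxy, h⟩ := h
  refine ⟨s * x, y, s * z, hxy.imp (mul_ne_zero hs) id, ?_⟩
  linear_combination s ^ 2 * h

/-- If `b c` is a norm `z² - a`, then `c` can be exchanged for `b`. -/
theorem SplitPair.of_mul_eq {a b c z : ℝ[X]} (h : SplitPair a c) (hc : c ≠ 0)
    (hz : z ^ 2 - a = b * c) : SplitPair a b := by
  obtain ⟨x, y, w, hxy, h⟩ := h
  by_cases hy : y = 0
  · subst hy
    exact ⟨x, 0, w, hxy, by rw [h]; ring⟩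
  · refine ⟨z * x + w, c * y, z * w + a * x, Or.inr (mul_ne_zero hc hy), ?_⟩
    linear_combination (z ^ 2 - a) * h + c * y ^ 2 * hz

theorem eventually_cofinite_eval_ne_zero {s : ℝ[X]} (hs : s ≠ 0) :
    ∀ᶠ t in Filter.cofinite, s.eval t ≠ 0 := by
  simpa [Filter.eventually_cofinite] using finite_setOfPred_isRoot hs

/-- The condition `a(t) < 0 → 0 ≤ b(t)` may be checked off a finite set. -/
theorem nonneg_of_eventually_cofinite {a b : ℝ[X]}
    (h : ∀ᶠ t in Filter.cofinite, a.eval t < 0 → 0 ≤ b.eval t) (t : ℝ) (ht : a.eval t < 0) :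
    0 ≤ b.eval t := by
  by_contra! hlt
  obtain ⟨u, ⟨hua, hub⟩, hu⟩ :=
    ((((a.continuous.continuousAt (x := t)).eventually_lt_const ht).and
      (b.continuous.continuousAt.eventually_lt_const hlt)).filter_mono
        nhdsWithin_le_nhds |>.and (h.filter_mono (nhdsNE_le_cofinite t))).exists
  exact absurd (hu hua) (not_le.mpr hub)

/-- Legendre descent over `ℝ[t]`. -/
theorem splitPair_of_nonneg (n : ℕ) : ∀ a b : ℝ[X], a.natDegree + b.natDegree ≤ n →
    a ≠ 0 → b ≠ 0 → (∀ t, a.eval t < 0 → 0 ≤ b.eval t) → SplitPair a b := by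
  induction n with
  | zero =>
    intro a b hn ha hb h
    obtain ⟨r, rfl⟩ := natDegree_eq_zero.mp (by omega : a.natDegree = 0)
    obtain ⟨s, rfl⟩ := natDegree_eq_zero.mp (by omega : b.natDegree = 0)
    simp only [eval_C, forall_const] at h
    rcases lt_or_ge r 0 with hr | hr
    · exact ⟨0, 1, C √s, by simp, by rw [← C_pow, Real.sq_sqrt (h hr)]; simp⟩
    · exact ⟨1, 0, C √r, by simp, by rw [← C_pow, Real.sq_sqrt hr]; simp⟩
  | succ n ih =>
    have main : ∀ a b : ℝ[X], a.natDegree + b.natDegree ≤ n + 1 → a.natDegree ≤ b.natDegree →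
        a ≠ 0 → b ≠ 0 → (∀ t, a.eval t < 0 → 0 ≤ b.eval t) → SplitPair a b := by
      intro a b hn hab ha hb h
      by_cases hb0 : b.natDegree = 0
      · exact ih a b (by omega) ha hb h
      by_cases hsq : Squarefree b
      · obtain ⟨z, hz⟩ := exists_dvd_sq_sub_of_squarefree hsq a fun t ht =>
          eval_nonneg_of_squarefree_root hsq
            (fun t ht => not_lt.mp fun h' => absurd (h t h') (not_le.mpr ht)) ht
        have hz' : b ∣ (z % b) ^ 2 - a := by
          have : (z % b) ^ 2 - a = (z ^ 2 - a) - b * (z / b) * (2 * z - b * (z / b)) := by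
            have := EuclideanDomain.div_add_mod z b
            linear_combination (z % b + z - b * (z / b)) * this
          rw [this]
          exact dvd_sub hz ⟨_, mul_assoc _ _ _⟩
        have hdeg : (z % b).natDegree < b.natDegree := natDegree_mod_lt z hb0
        generalize z % b = z at hz' hdeg
        obtain ⟨c, hc⟩ := hz'
        by_cases hc0 : c = 0
        · refine ⟨1, 0, z, by simp, ?_⟩
          rw [hc0] at hc
          linear_combination hc
        have hcdeg : c.natDegree < b.natDegree := by
          have h1 : (z ^ 2 - a).natDegree ≤ max (2 * z.natDegree) a.natDegree :=
            (natDegree_sub_le _ _).trans (max_le_max natDegree_pow_le le_rfl)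
          rw [hc, natDegree_mul hb hc0] at h1
          omega
        refine SplitPair.of_mul_eq (ih a c (by omega) ha hc0 fun t ht => ?_) hc0 hc
        have h2 := congr_arg (eval t) hc
        simp only [eval_sub, eval_pow, eval_mul] at h2
        -- Where `a < 0`, `b c = z² - a` is positive, so `c` inherits the sign of `b`.
        have h3 : 0 < eval t b * eval t c := by rw [← h2]; nlinarith [sq_nonneg (eval t z)]
        exact (pos_of_mul_pos_right h3 (h t ht)).le
      · simp only [Squarefree, not_forall] at hsq
        obtain ⟨s, ⟨c, rfl⟩, hs⟩ := hsq
        have hs0 : s ≠ 0 := by rintro rfl; simp at hb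
        have hc0 : c ≠ 0 := right_ne_zero_of_mul hb
        have hsdeg : 0 < s.natDegree := by
          rw [pos_iff_ne_zero]
          exact fun h0 => hs (isUnit_iff_degree_eq_zero.mpr (by
            rw [degree_eq_natDegree hs0, h0]; rfl))
        rw [natDegree_mul (mul_ne_zero hs0 hs0) hc0, natDegree_mul hs0 hs0] at hn
        rw [← sq]
        refine (ih a c (by omega) ha hc0 (nonneg_of_eventually_cofinite
          ((eventually_cofinite_eval_ne_zero hs0).mono fun t hst ht => ?_))).mul_sq hs0
        have := h t ht
        rw [eval_mul, eval_mul] at this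
        exact nonneg_of_mul_nonneg_right this (mul_self_pos.mpr hst)
    intro a b hn ha hb h
    rcases le_total a.natDegree b.natDegree with hab | hab
    · exact main a b hn hab ha hb h
    · exact (main b a (by omega) hab hb ha fun t ht =>
        not_lt.mp fun h' => absurd (h t h') (not_le.mpr ht)).symm

end

/-! ### Equivalence of binary forms over `ℝ(t)`. -/

theorem diagForm_apply (A B : Polynomial ℝ) (v : Fin 2 → RatFunc ℝ) :
    diagForm A B v =
      algebraMap _ (RatFunc ℝ) A * v 0 ^ 2 + algebraMap _ (RatFunc ℝ) B * v 1 ^ 2 := by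
  simp [diagForm, QuadraticMap.weightedSumSquares_apply, Fin.sum_univ_two, sq]

theorem algebraMap_ratFunc_ne_zero {A : Polynomial ℝ} (hA : A ≠ 0) :
    algebraMap (Polynomial ℝ) (RatFunc ℝ) A ≠ 0 :=
  (map_ne_zero_iff _ (RatFunc.algebraMap_injective ℝ)).mpr hA

/-- An equivalence of binary forms amounts to an orthogonal basis with prescribed values. -/
theorem diagForm_equivalent_iff {A B : Polynomial ℝ} (hA : A ≠ 0) (hB : B ≠ 0)
    (C D : Polynomial ℝ) :
    (diagForm A B).Equivalent (diagForm C D) ↔ ∃ p q r s : RatFunc ℝ,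
      algebraMap _ (RatFunc ℝ) A = algebraMap _ _ C * p ^ 2 + algebraMap _ _ D * q ^ 2 ∧
      algebraMap _ (RatFunc ℝ) B = algebraMap _ _ C * r ^ 2 + algebraMap _ _ D * s ^ 2 ∧
      algebraMap _ (RatFunc ℝ) C * (p * r) + algebraMap _ _ D * (q * s) = 0 := by
  constructor
  · rintro ⟨e⟩
    have h1 := e.map_app ![1, 0]
    have h2 := e.map_app ![0, 1]
    have h3 := e.map_app (![1, 0] + ![0, 1])
    rw [show e (![1, 0] + ![0, 1]) = e ![1, 0] + e ![0, 1] from map_add e.toLinearEquiv _ _] at h3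
    simp only [diagForm_apply, Pi.add_apply, Matrix.cons_val_zero, Matrix.cons_val_one] at h1 h2 h3
    refine ⟨e ![1, 0] 0, e ![1, 0] 1, e ![0, 1] 0, e ![0, 1] 1, ?_, ?_, ?_⟩
    · linear_combination -h1
    · linear_combination -h2
    · linear_combination (h3 - h1 - h2) / 2
  · rintro ⟨p, q, r, s, h1, h2, h3⟩
    have hA' := algebraMap_ratFunc_ne_zero hA
    have hB' := algebraMap_ratFunc_ne_zero hB
    -- Gram determinant: `(Cp² + Dq²)(Cr² + Ds²) = (Cpr + Dqs)² + CD(ps - qr)²`.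
    have hdet : p * s - r * q ≠ 0 := fun h0 => mul_ne_zero hA' hB' <| by
      rw [h1, h2]
      linear_combination (algebraMap _ (RatFunc ℝ) C * (p * r) + algebraMap _ _ D * (q * s)) * h3 +
        algebraMap _ (RatFunc ℝ) C * algebraMap _ (RatFunc ℝ) D * (p * s - r * q) * h0
    let e : (Fin 2 → RatFunc ℝ) ≃ₗ[RatFunc ℝ] (Fin 2 → RatFunc ℝ) :=
      LinearMap.GeneralLinearGroup.generalLinearEquiv _ _ <|
        Matrix.GeneralLinearGroup.toLin <|
          Matrix.GeneralLinearGroup.mkOfDetNeZero !![p, r; q, s] (by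
            rwa [Matrix.det_fin_two_of])
    refine ⟨⟨e, fun v => ?_⟩⟩
    have h0 : e v 0 = p * v 0 + r * v 1 := by
      simp [e, Matrix.GeneralLinearGroup.toLin, Matrix.GeneralLinearGroup.mkOfDetNeZero,
        Matrix.mulVec, dotProduct, Fin.sum_univ_two]
    have h0' : e v 1 = q * v 0 + s * v 1 := by
      simp [e, Matrix.GeneralLinearGroup.toLin, Matrix.GeneralLinearGroup.mkOfDetNeZero,
        Matrix.mulVec, dotProduct, Fin.sum_univ_two]
    change diagForm C D (e v) = _
    rw [diagForm_apply, diagForm_apply, h0, h0']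
    linear_combination -v 0 ^ 2 * h1 - v 1 ^ 2 * h2 + 2 * v 0 * v 1 * h3

/-- If `⟨C, D⟩` represents `A` over `ℝ(t)`, then it represents some `A k²`, `k ≠ 0`, over `ℝ[t]`. -/
theorem exists_polynomial_representation {A C D : Polynomial ℝ} {p q : RatFunc ℝ}
    (h : algebraMap _ (RatFunc ℝ) A = algebraMap _ _ C * p ^ 2 + algebraMap _ _ D * q ^ 2) :
    ∃ x y k : Polynomial ℝ, k ≠ 0 ∧ A * k ^ 2 = C * x ^ 2 + D * y ^ 2 := by
  obtain ⟨x, u, hu, rfl⟩ := IsFractionRing.div_surjective (A := Polynomial ℝ) p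
  obtain ⟨y, v, hv, rfl⟩ := IsFractionRing.div_surjective (A := Polynomial ℝ) q
  have hu0 := nonZeroDivisors.ne_zero hu
  have hv0 := nonZeroDivisors.ne_zero hv
  refine ⟨x * v, y * u, u * v, mul_ne_zero hu0 hv0, RatFunc.algebraMap_injective ℝ ?_⟩
  have hu' := algebraMap_ratFunc_ne_zero hu0
  have hv' := algebraMap_ratFunc_ne_zero hv0
  field_simp at h
  simp only [map_mul, map_add, map_pow]
  linear_combination h

theorem isSquare_mul_iff_exists {A B C D : Polynomial ℝ} (hA : A ≠ 0) (hB : B ≠ 0)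
    (hC : C ≠ 0) (hD : D ≠ 0) :
    IsSquare (algebraMap (Polynomial ℝ) (RatFunc ℝ) (A * B * C * D)) ↔
      ∃ g : RatFunc ℝ, g ≠ 0 ∧
        algebraMap (Polynomial ℝ) (RatFunc ℝ) (A * B) =
          g ^ 2 * algebraMap (Polynomial ℝ) (RatFunc ℝ) (C * D) := by
  have hA' := algebraMap_ratFunc_ne_zero hA
  have hB' := algebraMap_ratFunc_ne_zero hB
  have hC' := algebraMap_ratFunc_ne_zero hC
  have hD' := algebraMap_ratFunc_ne_zero hD
  simp only [map_mul]
  constructor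
  · rintro ⟨s, hs⟩
    have hs0 : s ≠ 0 := by
      rintro rfl
      simp [hA', hB', hC', hD'] at hs
    refine ⟨s / (algebraMap _ _ C * algebraMap _ _ D), by positivity, ?_⟩
    field_simp
    linear_combination hs
  · rintro ⟨g, -, hg⟩
    exact ⟨g * (algebraMap _ _ C * algebraMap _ _ D), by
      linear_combination algebraMap _ (RatFunc ℝ) C * algebraMap _ (RatFunc ℝ) D * hg⟩

theorem eventually_pos_of_isSquare {F : Polynomial ℝ} (hF : F ≠ 0)
    (h : IsSquare (algebraMap (Polynomial ℝ) (RatFunc ℝ) F)) :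
    ∀ᶠ t in Filter.cofinite, 0 < F.eval t := by
  obtain ⟨s, hs⟩ := h
  obtain ⟨x, y, k, hk, hxy⟩ := exists_polynomial_representation (A := F) (C := 1) (D := 0)
    (p := s) (q := 0) (by rw [hs]; simp [sq])
  filter_upwards [eventually_cofinite_eval_ne_zero hF, eventually_cofinite_eval_ne_zero hk]
    with t ht hkt
  have := congr_arg (Polynomial.eval t) hxy
  simp only [Polynomial.eval_mul, Polynomial.eval_pow, zero_mul, one_mul, add_zero] at this
  refine lt_of_le_of_ne (not_lt.mp fun hneg => ?_) ht.symm
  nlinarith [mul_neg_of_neg_of_pos hneg (pow_pos (sq_pos_of_ne_zero hkt) 1),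
    sq_nonneg (Polynomial.eval t x)]

/-- Binary forms over `ℝ(t)` are equivalent iff their discriminants agree up to squares and their
signatures agree at almost all real points. -/
theorem diagForm_equivalent_iff_eventually {A B C D : Polynomial ℝ} (hA : A ≠ 0) (hB : B ≠ 0)
    (hC : C ≠ 0) (hD : D ≠ 0) :
    (diagForm A B).Equivalent (diagForm C D) ↔
      IsSquare (algebraMap (Polynomial ℝ) (RatFunc ℝ) (A * B * C * D)) ∧
      ∀ᶠ t in Filter.cofinite, A.eval t * B.eval t < 0 ∨ 0 < A.eval t * C.eval t := by
  have hA' := algebraMap_ratFunc_ne_zero hA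
  have hB' := algebraMap_ratFunc_ne_zero hB
  have hC' := algebraMap_ratFunc_ne_zero hC
  have hD' := algebraMap_ratFunc_ne_zero hD
  constructor
  · intro h
    obtain ⟨p, q, r, s, h1, h2, h3⟩ := (diagForm_equivalent_iff hA hB C D).mp h
    have hsq : IsSquare (algebraMap (Polynomial ℝ) (RatFunc ℝ) (A * B * C * D)) := by
      refine ⟨algebraMap _ _ C * algebraMap _ _ D * (p * s - q * r), ?_⟩
      simp only [map_mul]
      rw [h1, h2]
      linear_combination algebraMap _ (RatFunc ℝ) C * algebraMap _ (RatFunc ℝ) D *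
        (algebraMap _ (RatFunc ℝ) C * (p * r) + algebraMap _ _ D * (q * s)) * h3
    refine ⟨hsq, ?_⟩
    obtain ⟨x, y, k, hk, hxy⟩ := exists_polynomial_representation h1
    filter_upwards [eventually_pos_of_isSquare (by simp [*]) hsq,
      eventually_cofinite_eval_ne_zero hk] with t hpos hkt
    have := congr_arg (Polynomial.eval t) hxy
    simp only [Polynomial.eval_mul, Polynomial.eval_pow, Polynomial.eval_add] at this hpos
    generalize A.eval t = a, B.eval t = b, C.eval t = c, D.eval t = d, k.eval t = k,
      x.eval t = x, y.eval t = y at *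
    by_contra! hcon
    obtain ⟨hab, hac⟩ := hcon
    have hcd : 0 < c * d := by
      rw [mul_assoc] at hpos
      exact pos_of_mul_pos_right hpos hab
    have ha0 : a ≠ 0 := by rintro rfl; simp at hpos
    have hc0 : c ≠ 0 := by rintro rfl; simp at hcd
    -- Here `c d > 0`, so the form `⟨c, d⟩` is definite and its values have the sign of `c`.
    have e1 : (a * c) * k ^ 2 = (c * x) ^ 2 + (c * d) * y ^ 2 := by linear_combination c * this
    have e2 : a * c < 0 := lt_of_le_of_ne hac (mul_ne_zero ha0 hc0)
    nlinarith [mul_neg_of_neg_of_pos e2 (sq_pos_of_ne_zero hkt), mul_nonneg hcd.le (sq_nonneg y),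
      sq_nonneg (c * x)]
  · rintro ⟨hsq, hev⟩
    obtain ⟨g, hg, hABg⟩ := (isSquare_mul_iff_exists hA hB hC hD).mp hsq
    have hsplit : SplitPair (A * C) (-(A * B)) := by
      refine splitPair_of_nonneg _ _ _ le_rfl (by simp [*]) (by simp [*])
        (nonneg_of_eventually_cofinite (hev.mono fun t ht hneg => ?_))
      simp only [Polynomial.eval_mul, Polynomial.eval_neg] at hneg ⊢
      rcases ht with ht | ht <;> linarith
    obtain ⟨x, y, z, hxy, hz⟩ := hsplit
    have hz := congr_arg (algebraMap (Polynomial ℝ) (RatFunc ℝ)) hz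
    simp only [map_mul, map_add, map_pow, map_neg] at hz hABg
    suffices hrep : ∃ p q : RatFunc ℝ,
        algebraMap _ (RatFunc ℝ) C = algebraMap _ _ A * p ^ 2 + algebraMap _ _ B * q ^ 2 by
      obtain ⟨p, q, hpq⟩ := hrep
      -- The vector `(-Bq, Ap)` is orthogonal to `(p, q)` and has value `A B C = g² C² D`; dividing
      -- it by `g C` gives the value `D`.
      refine QuadraticMap.Equivalent.symm ((diagForm_equivalent_iff hC hD A B).mpr
        ⟨p, q, -algebraMap _ _ B * q / (g * algebraMap _ _ C),
          algebraMap _ _ A * p / (g * algebraMap _ _ C), hpq, ?_, by field_simp; ring⟩)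
      field_simp
      linear_combination -(algebraMap _ (RatFunc ℝ) C) * hABg +
        algebraMap _ (RatFunc ℝ) A * algebraMap _ (RatFunc ℝ) B * hpq
    by_cases hx : x = 0
    · have hy : algebraMap (Polynomial ℝ) (RatFunc ℝ) y ≠ 0 :=
        algebraMap_ratFunc_ne_zero (hxy.resolve_left (not_not.mpr hx))
      have hz0 : algebraMap (Polynomial ℝ) (RatFunc ℝ) z ≠ 0 := by
        intro h0
        simp [h0, hx, hA', hB', hy] at hz
      simp only [hx, map_zero] at hz
      -- Now `-A B` is a square, so `⟨A, B⟩` is hyperbolic and represents everything; the witnesses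
      -- come from `AC = ((AC + 1)/2)² - ((AC - 1)/2)²`.
      refine ⟨(algebraMap _ _ A * algebraMap _ _ C + 1) / (2 * algebraMap _ _ A),
        (algebraMap _ _ A * algebraMap _ _ C - 1) * algebraMap _ _ y / (2 * algebraMap _ _ z), ?_⟩
      field_simp
      linear_combination -(algebraMap _ (RatFunc ℝ) A * algebraMap _ _ C - 1) ^ 2 * hz
    · have hx := algebraMap_ratFunc_ne_zero hx
      refine ⟨algebraMap _ _ z / (algebraMap _ _ A * algebraMap _ _ x),
        algebraMap _ _ y / algebraMap _ _ x, ?_⟩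
      field_simp
      linear_combination -hz

/-! ### Signs near roots and at infinity. -/

section

open Polynomial Filter Topology

/-- The sign of `P` on the side of `ε` given by `σ = 1` (right) or `σ = -1` (left), as a real
number: for squarefree `P` it has the sign of `P` near `ε` on that side. -/
noncomputable def sideSign (P : ℝ[X]) (σ ε : ℝ) : ℝ :=
  open Classical in if P.eval ε = 0 then σ * quotEval P ε else P.eval ε

theorem eq_mul_divByMonic_of_eval_eq_zero {P : ℝ[X]} {ε : ℝ} (h : P.eval ε = 0) :
    P = (X - C ε) * (P /ₘ (X - C ε)) :=
  (mul_divByMonic_eq_iff_isRoot.mpr h).symm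

theorem quotEval_ne_zero {P : ℝ[X]} (hP : Squarefree P) {ε : ℝ} (h : P.eval ε = 0) :
    quotEval P ε ≠ 0 := fun h0 => by
  obtain ⟨r, hr⟩ := dvd_iff_isRoot.mpr h0
  exact not_isUnit_X_sub_C ε (hP _ ⟨r, by
    rw [mul_assoc, ← hr]; exact eq_mul_divByMonic_of_eval_eq_zero h⟩)

theorem eventually_eval_mul_pos {P : ℝ[X]} {ε : ℝ} (h : P.eval ε ≠ 0) :
    ∀ᶠ t in 𝓝 ε, 0 < P.eval t * P.eval ε :=
  (P.continuous.mul continuous_const).continuousAt.eventually_const_lt (mul_self_pos.mpr h)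

theorem eventually_nhdsGT_sideSign {P : ℝ[X]} (hP : Squarefree P) (ε : ℝ) :
    ∀ᶠ t in 𝓝[>] ε, 0 < P.eval t * sideSign P 1 ε := by
  rw [sideSign]
  split_ifs with h
  · filter_upwards [(eventually_eval_mul_pos (quotEval_ne_zero hP h)).filter_mono
      nhdsWithin_le_nhds, self_mem_nhdsWithin] with t ht hlt
    rw [eq_mul_divByMonic_of_eval_eq_zero h, eval_mul, ← eq_mul_divByMonic_of_eval_eq_zero h]
    have := mul_pos (sub_pos.mpr hlt) ht
    simp only [eval_sub, eval_X, eval_C, quotEval] at this ⊢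
    linarith
  · exact (eventually_eval_mul_pos h).filter_mono nhdsWithin_le_nhds

theorem eventually_nhdsLT_sideSign {P : ℝ[X]} (hP : Squarefree P) (ε : ℝ) :
    ∀ᶠ t in 𝓝[<] ε, 0 < P.eval t * sideSign P (-1) ε := by
  rw [sideSign]
  split_ifs with h
  · filter_upwards [(eventually_eval_mul_pos (quotEval_ne_zero hP h)).filter_mono
      nhdsWithin_le_nhds, self_mem_nhdsWithin] with t ht hlt
    rw [eq_mul_divByMonic_of_eval_eq_zero h, eval_mul, ← eq_mul_divByMonic_of_eval_eq_zero h]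
    have := mul_pos (sub_pos.mpr hlt) ht
    simp only [eval_sub, eval_X, eval_C, quotEval] at this ⊢
    linarith
  · exact (eventually_eval_mul_pos h).filter_mono nhdsWithin_le_nhds

theorem eventually_atTop_eval_mul_leadingCoeff {P : ℝ[X]} (hP : P ≠ 0) :
    ∀ᶠ t in atTop, 0 < P.eval t * P.leadingCoeff := by
  by_cases h0 : P.natDegree = 0
  · rw [eq_C_of_natDegree_eq_zero h0] at hP ⊢
    have : P.coeff 0 ≠ 0 := by simpa using hP
    simp [this]
  · have h := tendsto_atTop_of_leadingCoeff_nonneg (P * C P.leadingCoeff)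
      (by rw [degree_mul_C (leadingCoeff_ne_zero.mpr hP)]
          exact natDegree_pos_iff_degree_pos.mp (Nat.pos_of_ne_zero h0))
      (by simpa using mul_self_nonneg _)
    simpa using h.eventually_gt_atTop 0

theorem eventually_atBot_eval_mul_leadingCoeff {P : ℝ[X]} (hP : P ≠ 0) :
    ∀ᶠ t in atBot, 0 < P.eval t * ((-1) ^ P.natDegree * P.leadingCoeff) := by
  have h := eventually_atTop_eval_mul_leadingCoeff (P := P.comp (-X))
    (by simpa [comp_eq_zero_iff] using hP)
  filter_upwards [tendsto_neg_atBot_atTop.eventually h] with t ht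
  simpa [mul_comm] using ht

theorem mul_pos_iff_of_ne {x y : ℝ} (hx : x ≠ 0) (hy : y ≠ 0) : 0 < x * y ↔ (0 < x ↔ 0 < y) := by
  rcases hx.lt_or_gt with h | h <;> rcases hy.lt_or_gt with h' | h' <;>
    simp [h, h', mul_pos_iff, h.not_gt, h'.not_gt]

theorem mul_neg_iff_of_ne {x y : ℝ} (hx : x ≠ 0) (hy : y ≠ 0) : x * y < 0 ↔ ¬(0 < x ↔ 0 < y) := by
  rw [← mul_pos_iff_of_ne hx hy, not_lt, le_iff_lt_or_eq]
  simp [hx, hy]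

theorem mul_mul_mul_pos_iff_of_ne {x y z w : ℝ} (hx : x ≠ 0) (hy : y ≠ 0) (hz : z ≠ 0)
    (hw : w ≠ 0) : 0 < x * y * z * w ↔ ((0 < x ↔ 0 < y) ↔ (0 < z ↔ 0 < w)) := by
  rw [mul_assoc (x * y), mul_pos_iff_of_ne (mul_ne_zero hx hy) (mul_ne_zero hz hw),
    mul_pos_iff_of_ne hx hy, mul_pos_iff_of_ne hz hw]

theorem neg_iff_not_pos_of_ne {x : ℝ} (hx : x ≠ 0) : x < 0 ↔ ¬0 < x := by
  rw [not_lt, le_iff_lt_or_eq]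
  simp [hx]

/-- The real numbers `a, b` and `c, d` are the coefficients of binary forms over `ℝ` with the same
signature, provided that `a b c d > 0`. -/
def SameSignature (a b c : ℝ) : Prop := a * b < 0 ∨ 0 < a * c

theorem sameSignature_congr {a b c a' b' c' : ℝ} (ha : 0 < a * a') (hb : 0 < b * b')
    (hc : 0 < c * c') : SameSignature a b c ↔ SameSignature a' b' c' := by
  have ha0 := left_ne_zero_of_mul ha.ne'
  have ha1 := right_ne_zero_of_mul ha.ne'
  have hb0 := left_ne_zero_of_mul hb.ne'
  have hb1 := right_ne_zero_of_mul hb.ne'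
  have hc0 := left_ne_zero_of_mul hc.ne'
  have hc1 := right_ne_zero_of_mul hc.ne'
  simp only [SameSignature, mul_pos_iff_of_ne, mul_neg_iff_of_ne, ne_eq, ha0, ha1, hb0, hb1, hc0, hc1,
    not_false_eq_true] at *
  tauto

/-- The sign condition at a single point `ε`. -/
def SignCondAt (A B C D : ℝ[X]) (ε : ℝ) : Prop :=
  A.eval ε = 0 →
    (B.eval ε ≠ 0 →
      (C.eval ε = 0 → 0 < quotEval A ε * quotEval C ε) ∧
      (D.eval ε = 0 → 0 < quotEval A ε * quotEval D ε)) ∧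
    (B.eval ε = 0 → C.eval ε ≠ 0 → D.eval ε ≠ 0 →
      quotEval A ε * quotEval B ε < 0) ∧
    (B.eval ε = 0 → C.eval ε = 0 → D.eval ε = 0 →
      (quotEval A ε * quotEval B ε < 0 ∧ quotEval C ε * quotEval D ε < 0) ∨
      AllSameSign (quotEval A ε) (quotEval B ε) (quotEval C ε) (quotEval D ε))

/-- Comparing `hr` with `hl` shows that an even number of the four polynomials vanish at `ε`. If
only `A, B` vanish, then `A B > 0` would make `A C` change sign, so `A B < 0` is forced. If only `A,
C` vanish, `A B > 0` on one side, and the constant sign of `A C` must be positive. Everything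
depends only on signs, so each case is propositional. -/
theorem signCondAt_iff_sameSignature {A B C D : ℝ[X]} (hA : Squarefree A) (hB : Squarefree B)
    (hC : Squarefree C) (hD : Squarefree D) (ε : ℝ)
    (hr : 0 < sideSign A 1 ε * sideSign B 1 ε * sideSign C 1 ε * sideSign D 1 ε)
    (hl : 0 < sideSign A (-1) ε * sideSign B (-1) ε * sideSign C (-1) ε * sideSign D (-1) ε)
    (h0 : A.eval ε = 0 ∨ B.eval ε = 0 ∨ C.eval ε = 0 ∨ D.eval ε = 0) :
    (SignCondAt A B C D ε ∧ SignCondAt B A C D ε ∧ SignCondAt C D A B ε ∧ SignCondAt D C A B ε) ↔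
      SameSignature (sideSign A 1 ε) (sideSign B 1 ε) (sideSign C 1 ε) ∧
      SameSignature (sideSign A (-1) ε) (sideSign B (-1) ε) (sideSign C (-1) ε) := by
  have hA := quotEval_ne_zero hA (ε := ε)
  have hB := quotEval_ne_zero hB (ε := ε)
  have hC := quotEval_ne_zero hC (ε := ε)
  have hD := quotEval_ne_zero hD (ε := ε)
  simp only [sideSign, SignCondAt, AllSameSign, SameSignature] at *
  generalize quotEval A ε = qa, quotEval B ε = qb, quotEval C ε = qc, quotEval D ε = qd,
    A.eval ε = a, B.eval ε = b, C.eval ε = c, D.eval ε = d at *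
  have hneg : ∀ {x : ℝ}, x ≠ 0 → (0 < -x ↔ ¬0 < x) := fun hx => by
    rw [neg_pos, neg_iff_not_pos_of_ne hx]
  by_cases ha : a = 0 <;> by_cases hb : b = 0 <;> by_cases hc : c = 0 <;> by_cases hd : d = 0 <;>
  simp only [ha, hb, hc, hd, forall_const, not_true_eq_false, ne_eq, if_true, if_false,
      IsEmpty.forall_iff, neg_one_mul, one_mul, or_false, or_true, true_and, and_true] at hr hl h0 hA hB hC hD ⊢ <;>
  simp only [mul_pos_iff_of_ne, mul_neg_iff_of_ne, mul_mul_mul_pos_iff_of_ne, neg_ne_zero, hneg,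
      neg_iff_not_pos_of_ne, ne_eq, ha, hb, hc, hd, hA, hB, hC, hD, not_false_eq_true] at hr hl ⊢ <;>
  clear hneg <;> grind

theorem eval_mul_eval_pos_of_isPreconnected {P : ℝ[X]} {s : Set ℝ} (hs : IsPreconnected s)
    (h : ∀ t ∈ s, P.eval t ≠ 0) {t u : ℝ} (ht : t ∈ s) (hu : u ∈ s) :
    0 < P.eval t * P.eval u := by
  rw [mul_pos_iff_of_ne (h t ht) (h u hu)]
  have key : ∀ {t u}, t ∈ s → u ∈ s → 0 < P.eval t → 0 < P.eval u := by
    intro t u ht hu hpos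
    by_contra! hneg
    obtain ⟨v, hv, hv0⟩ := hs.intermediate_value hu ht P.continuous.continuousOn ⟨hneg, hpos.le⟩
    exact h v hv hv0
  exact ⟨key ht hu, key hu ht⟩

theorem mul_pos_trans {x y z : ℝ} (h : 0 < x * y) (h' : 0 < x * z) : 0 < y * z := by
  have hx := left_ne_zero_of_mul h.ne'
  have hy := right_ne_zero_of_mul h.ne'
  have hz := right_ne_zero_of_mul h'.ne'
  rw [mul_pos_iff_of_ne ‹_› ‹_›] at *
  tauto

theorem even_natDegree_of_eval_ne_zero {P : ℝ[X]} (h : ∀ t, P.eval t ≠ 0) :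
    Even P.natDegree := by
  have hP : P ≠ 0 := by rintro rfl; simp at h
  by_contra hodd
  obtain ⟨t, ht⟩ := (eventually_atTop_eval_mul_leadingCoeff hP).exists
  obtain ⟨u, hu⟩ := (eventually_atBot_eval_mul_leadingCoeff hP).exists
  rw [(Nat.not_even_iff_odd.mp hodd).neg_one_pow] at hu
  have h1 := mul_pos_trans (eval_mul_eval_pos_of_isPreconnected isPreconnected_univ
    (fun t _ => h t) (Set.mem_univ t) (Set.mem_univ u)) ht
  have h2 := mul_pos_trans h1 hu
  nlinarith [mul_self_nonneg P.leadingCoeff]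

/-- Signs along a filter determine the signature condition. -/
theorem signs_of_le_cofinite {A B C D : ℝ[X]} {l : Filter ℝ} [l.NeBot] (hl : l ≤ cofinite)
    (hF : ∀ᶠ t in cofinite, 0 < (A * B * C * D).eval t) {a b c d : ℝ}
    (ha : ∀ᶠ t in l, 0 < A.eval t * a) (hb : ∀ᶠ t in l, 0 < B.eval t * b)
    (hc : ∀ᶠ t in l, 0 < C.eval t * c) (hd : ∀ᶠ t in l, 0 < D.eval t * d) :
    0 < a * b * c * d ∧
    ((∀ᶠ t in cofinite, SameSignature (A.eval t) (B.eval t) (C.eval t)) →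
      SameSignature a b c) := by
  constructor
  · obtain ⟨t, hF, ha, hb, hc, hd⟩ :=
      ((hF.filter_mono hl).and (ha.and (hb.and (hc.and hd)))).exists
    simp only [eval_mul] at hF
    refine pos_of_mul_pos_right (a := A.eval t * B.eval t * C.eval t * D.eval t) ?_ hF.le
    have := mul_pos (mul_pos (mul_pos ha hb) hc) hd
    linarith
  · intro h
    obtain ⟨t, h, ha, hb, hc⟩ := ((h.filter_mono hl).and (ha.and (hb.and hc))).exists
    exact (sameSignature_congr ha hb hc).mp h

/-- The analogue at infinity of the analysis at a root: odd degree plays the role of vanishing,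
since exactly then the signs at `±∞` differ. -/
theorem degreeCond_of_sameSignature {A B C D : ℝ[X]} (hA : A ≠ 0) (hB : B ≠ 0) (hC : C ≠ 0)
    (hD : D ≠ 0) (hF : ∀ᶠ t in cofinite, 0 < (A * B * C * D).eval t)
    (h : ∀ᶠ t in cofinite, SameSignature (A.eval t) (B.eval t) (C.eval t)) :
    DegreeCond A B C D := by
  obtain ⟨h1, h2⟩ := signs_of_le_cofinite atTop_le_cofinite hF
    (eventually_atTop_eval_mul_leadingCoeff hA) (eventually_atTop_eval_mul_leadingCoeff hB)
    (eventually_atTop_eval_mul_leadingCoeff hC) (eventually_atTop_eval_mul_leadingCoeff hD)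
  obtain ⟨h3, h4⟩ := signs_of_le_cofinite atBot_le_cofinite hF
    (eventually_atBot_eval_mul_leadingCoeff hA) (eventually_atBot_eval_mul_leadingCoeff hB)
    (eventually_atBot_eval_mul_leadingCoeff hC) (eventually_atBot_eval_mul_leadingCoeff hD)
  replace h2 := h2 h
  replace h4 := h4 h
  have hA := leadingCoeff_ne_zero.mpr hA
  have hB := leadingCoeff_ne_zero.mpr hB
  have hC := leadingCoeff_ne_zero.mpr hC
  have hD := leadingCoeff_ne_zero.mpr hD
  have hneg : ∀ {x : ℝ}, x ≠ 0 → (0 < -x ↔ ¬0 < x) := fun hx => by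
    rw [neg_pos, neg_iff_not_pos_of_ne hx]
  simp only [DegreeCond, AllSameSign, SameSignature, Set.mem_insert_iff, Set.mem_singleton_iff,
    forall_eq_or_imp, forall_eq] at *
  generalize A.leadingCoeff = a, B.leadingCoeff = b, C.leadingCoeff = c,
    D.leadingCoeff = d at *
  rcases Nat.even_or_odd A.natDegree with pa | pa <;>
  rcases Nat.even_or_odd B.natDegree with pb | pb <;>
  rcases Nat.even_or_odd C.natDegree with pc | pc <;>
  rcases Nat.even_or_odd D.natDegree with pd | pd <;>
  simp only [pa.neg_one_pow, pb.neg_one_pow, pc.neg_one_pow, pd.neg_one_pow, one_mul,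
    neg_one_mul] at h3 h4 <;>
  simp only [← Nat.not_even_iff_odd, xor_def] at pa pb pc pd ⊢ <;>
  simp only [pa, pb, pc, pd, mul_pos_iff_of_ne, mul_neg_iff_of_ne, mul_mul_mul_pos_iff_of_ne, neg_ne_zero, hneg,
    neg_iff_not_pos_of_ne, ne_eq, hA, hB, hC, hD, not_false_eq_true] at h1 h2 h3 h4 ⊢ <;>
  clear hneg <;> grind

/-- Serves the case without real roots, where all degrees are even. -/
theorem sameSignature_leadingCoeff_of_degreeCond {A B C D : ℝ[X]} (hA : Even A.natDegree)
    (hB : Even B.natDegree) (hC : Even C.natDegree) (hD : Even D.natDegree)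
    (h : DegreeCond A B C D) :
    SameSignature A.leadingCoeff B.leadingCoeff C.leadingCoeff := by
  simp only [DegreeCond, ← Nat.not_even_iff_odd, hA, hB, hC, hD, xor_def, not_true_eq_false,
    false_and, and_false, or_self, true_and, false_or] at h
  rcases h with h | h | h
  · exact Or.inl h.1
  · exact Or.inr (mul_pos h.1 h.2.2.1)
  · exact Or.inr (mul_pos_of_neg_of_neg h.1 h.2.2.1)

/-! ### From local sign conditions to signatures at almost all points. -/

theorem signCondAtRoots_iff (A B C D : ℝ[X]) : SignCondAtRoots A B C D ↔
    ∀ ε, SignCondAt A B C D ε ∧ SignCondAt B A C D ε ∧ SignCondAt C D A B ε ∧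
      SignCondAt D C A B ε := by
  simp only [forall_and]
  rfl

/-- Under the discriminant condition, the conditions at the roots and at infinity say that the
signatures agree at almost all real points. -/
theorem signCond_and_degreeCond_iff {A B C D : ℝ[X]} (hA : Squarefree A) (hB : Squarefree B)
    (hC : Squarefree C) (hD : Squarefree D)
    (hF : ∀ᶠ t in cofinite, 0 < (A * B * C * D).eval t) :
    SignCondAtRoots A B C D ∧ DegreeCond A B C D ↔
      ∀ᶠ t in cofinite, SameSignature (A.eval t) (B.eval t) (C.eval t) := by
  have hgt : ∀ ε : ℝ, 𝓝[>] ε ≤ cofinite := fun ε =>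
    (nhdsGT_le_nhdsNE ε).trans (nhdsNE_le_cofinite ε)
  have hlt : ∀ ε : ℝ, 𝓝[<] ε ≤ cofinite := fun ε =>
    (nhdsLT_le_nhdsNE ε).trans (nhdsNE_le_cofinite ε)
  have hright := fun ε => signs_of_le_cofinite (hgt ε) hF (eventually_nhdsGT_sideSign hA ε)
    (eventually_nhdsGT_sideSign hB ε) (eventually_nhdsGT_sideSign hC ε)
    (eventually_nhdsGT_sideSign hD ε)
  have hleft := fun ε => signs_of_le_cofinite (hlt ε) hF (eventually_nhdsLT_sideSign hA ε)
    (eventually_nhdsLT_sideSign hB ε) (eventually_nhdsLT_sideSign hC ε)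
    (eventually_nhdsLT_sideSign hD ε)
  have hroot := fun ε =>
    signCondAt_iff_sameSignature hA hB hC hD ε (hright ε).1 (hleft ε).1
  rw [signCondAtRoots_iff]
  constructor
  · rintro ⟨hsign, hdeg⟩
    have hF0 : A * B * C * D ≠ 0 :=
      mul_ne_zero (mul_ne_zero (mul_ne_zero hA.ne_zero hB.ne_zero) hC.ne_zero) hD.ne_zero
    have hor : ∀ ε, (A * B * C * D).eval ε = 0 →
        A.eval ε = 0 ∨ B.eval ε = 0 ∨ C.eval ε = 0 ∨ D.eval ε = 0 := fun ε h => by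
      simpa [or_assoc] using h
    have hroot' := fun ε h => (hroot ε (hor ε h)).mp (hsign ε)
    have hfin : {t | (A * B * C * D).eval t = 0}.Finite := finite_setOfPred_isRoot hF0
    filter_upwards [eventually_cofinite_eval_ne_zero hF0] with t₀ ht₀
    -- On a connected root-free set the signs are constant, so the signature at `t₀` can be read off
    -- along any filter living on that set.
    have key : ∀ (s : Set ℝ), IsPreconnected s → t₀ ∈ s →
        (∀ t ∈ s, (A * B * C * D).eval t ≠ 0) → ∀ (l : Filter ℝ) [l.NeBot], s ∈ l →
        ∀ {a b c : ℝ}, (∀ᶠ t in l, 0 < A.eval t * a) → (∀ᶠ t in l, 0 < B.eval t * b) →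
        (∀ᶠ t in l, 0 < C.eval t * c) → SameSignature a b c →
        SameSignature (A.eval t₀) (B.eval t₀) (C.eval t₀) := by
      intro s hs hts hne l _ hsl a b c ha hb hc h
      obtain ⟨t, ht, ha, hb, hc⟩ := ((show ∀ᶠ t in l, t ∈ s from hsl).and
        (ha.and (hb.and hc))).exists
      have hne' : ∀ t ∈ s, ((A.eval t ≠ 0 ∧ B.eval t ≠ 0) ∧ C.eval t ≠ 0) ∧ D.eval t ≠ 0 :=
        fun t ht => by simpa [not_or] using hne t ht
      refine (sameSignature_congr ?_ ?_ ?_).mp h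
      · exact mul_pos_trans ha (eval_mul_eval_pos_of_isPreconnected hs
          (fun t ht => (hne' t ht).1.1.1) ht hts)
      · exact mul_pos_trans hb (eval_mul_eval_pos_of_isPreconnected hs
          (fun t ht => (hne' t ht).1.1.2) ht hts)
      · exact mul_pos_trans hc (eval_mul_eval_pos_of_isPreconnected hs
          (fun t ht => (hne' t ht).1.2) ht hts)
    -- Use the nearest root to the right of `t₀`, failing that the nearest to the left; only if
    -- there is none is the degree condition needed.
    by_cases hR : ∃ ε, t₀ < ε ∧ (A * B * C * D).eval ε = 0
    · obtain ⟨ε, ⟨hlt₀, hε⟩, hmin⟩ := Set.exists_min_image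
        {ε | t₀ < ε ∧ (A * B * C * D).eval ε = 0} id (hfin.subset fun t ht => ht.2) hR
      refine key (Set.Ico t₀ ε) isPreconnected_Ico ⟨le_rfl, hlt₀⟩ (fun t ht h0 => ?_) (𝓝[<] ε)
        (Filter.mem_of_superset (Ioo_mem_nhdsLT hlt₀) Set.Ioo_subset_Ico_self)
        (eventually_nhdsLT_sideSign hA ε) (eventually_nhdsLT_sideSign hB ε)
        (eventually_nhdsLT_sideSign hC ε) (hroot' ε hε).2
      rcases ht.1.eq_or_lt with rfl | hlt'
      · exact ht₀ h0
      · exact absurd (hmin t ⟨hlt', h0⟩) (not_le.mpr ht.2)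
    by_cases hL : ∃ ε, ε < t₀ ∧ (A * B * C * D).eval ε = 0
    · obtain ⟨ε, ⟨hlt₀, hε⟩, hmax⟩ := Set.exists_max_image
        {ε | ε < t₀ ∧ (A * B * C * D).eval ε = 0} id (hfin.subset fun t ht => ht.2) hL
      refine key (Set.Ioc ε t₀) isPreconnected_Ioc ⟨hlt₀, le_rfl⟩ (fun t ht h0 => ?_) (𝓝[>] ε)
        (Filter.mem_of_superset (Ioo_mem_nhdsGT hlt₀) Set.Ioo_subset_Ioc_self)
        (eventually_nhdsGT_sideSign hA ε) (eventually_nhdsGT_sideSign hB ε)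
        (eventually_nhdsGT_sideSign hC ε) (hroot' ε hε).1
      rcases ht.2.eq_or_lt with rfl | hlt'
      · exact ht₀ h0
      · exact absurd (hmax t ⟨hlt', h0⟩) (not_le.mpr ht.1)
    push Not at hR hL
    have hne : ∀ t, (A * B * C * D).eval t ≠ 0 := fun t => by
      rcases lt_trichotomy t t₀ with h | rfl | h
      exacts [hL t h, ht₀, hR t h]
    have hne' : ∀ t, ((A.eval t ≠ 0 ∧ B.eval t ≠ 0) ∧ C.eval t ≠ 0) ∧ D.eval t ≠ 0 :=
      fun t => by simpa [not_or] using hne t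
    exact key Set.univ isPreconnected_univ (Set.mem_univ _) (fun t _ => hne t) atTop univ_mem
      (eventually_atTop_eval_mul_leadingCoeff hA.ne_zero)
      (eventually_atTop_eval_mul_leadingCoeff hB.ne_zero)
      (eventually_atTop_eval_mul_leadingCoeff hC.ne_zero)
      (sameSignature_leadingCoeff_of_degreeCond
        (even_natDegree_of_eval_ne_zero fun t => (hne' t).1.1.1)
        (even_natDegree_of_eval_ne_zero fun t => (hne' t).1.1.2)
        (even_natDegree_of_eval_ne_zero fun t => (hne' t).1.2)
        (even_natDegree_of_eval_ne_zero fun t => (hne' t).2) hdeg)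
  · intro h
    refine ⟨fun ε => ?_,
      degreeCond_of_sameSignature hA.ne_zero hB.ne_zero hC.ne_zero hD.ne_zero hF h⟩
    by_cases h0 : A.eval ε = 0 ∨ B.eval ε = 0 ∨ C.eval ε = 0 ∨ D.eval ε = 0
    · exact (hroot ε h0).mpr ⟨(hright ε).2 h, (hleft ε).2 h⟩
    · simp only [not_or] at h0
      exact ⟨fun h => absurd h h0.1, fun h => absurd h h0.2.1, fun h => absurd h h0.2.2.1,
        fun h => absurd h h0.2.2.2⟩

end

theorem mainTheorem10 (A B C D : Polynomial ℝ)
    (hA : Squarefree A) (hB : Squarefree B) (hC : Squarefree C) (hD : Squarefree D) :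
    ((diagForm A B).Equivalent (diagForm C D) ↔
      IsSquare (algebraMap (Polynomial ℝ) (RatFunc ℝ) (A * B * C * D)) ∧
      SignCondAtRoots A B C D ∧
      DegreeCond A B C D) ∧
    (IsSquare (algebraMap (Polynomial ℝ) (RatFunc ℝ) (A * B * C * D)) ↔
      ∃ g : RatFunc ℝ, g ≠ 0 ∧
        algebraMap (Polynomial ℝ) (RatFunc ℝ) (A * B) =
          g ^ 2 * algebraMap (Polynomial ℝ) (RatFunc ℝ) (C * D)) := by
  refine ⟨?_, isSquare_mul_iff_exists hA.ne_zero hB.ne_zero hC.ne_zero hD.ne_zero⟩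
  rw [diagForm_equivalent_iff_eventually hA.ne_zero hB.ne_zero hC.ne_zero hD.ne_zero]
  refine and_congr_right fun hsq => (signCond_and_degreeCond_iff hA hB hC hD ?_).symm
  exact eventually_pos_of_isSquare
    (mul_ne_zero (mul_ne_zero (mul_ne_zero hA.ne_zero hB.ne_zero) hC.ne_zero) hD.ne_zero) hsq
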